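/- For a real number $x$ let $\|x\|$ denote the distance from $x$ to the nearest integer. For $\Theta=(\theta^1,\theta^2,\theta^3)\in\mathbb{R}^3$ (one linear form in three variables, $m=3$, $n=1$) and $t\ge 1$ put $$\psi_\Theta(t)=\min_{\mathbf{x}\in\mathbb{Z}^3:\ 0<\max_i|x_i|\le t}\ \|\theta^1x_1+\theta^2x_2+\theta^3x_3\|,$$ and define the uniform and the individual Diophantine exponents $$\alpha(\Theta)=\sup\{\gamma>0:\ \limsup_{t\to+\infty}t^\gamma\psi_\Theta(t)<+\infty\},\qquad \beta(\Theta)=\sup\{\gamma>0:\ \liminf_{t\to+\infty}t^\gamma\psi_\Theta(t)<+\infty\},$$ the suprema being taken in $[-\infty,+\infty]$. For $\alpha\ge 3$ put $$g_2(\alpha)=\sqrt{\alpha+\frac1{\alpha^2}-\frac74}+\frac1\alpha-\frac12 .$$ Theorem 3. Suppose that $1,\theta^1,\theta^2,\theta^3$ are linearly independent over $\mathbb{Z}$. Then $\alpha(\Theta)\ge 3$ (so that $g_2(\alpha(\Theta))$ is defined when $\alpha(\Theta)$ is finite), and $$\beta(\Theta)\ \ge\ \alpha(\Theta)\,g_2(\alpha(\Theta)),$$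 where for $\alpha(\Theta)=+\infty$ the right-hand side is understood as $+\infty$, so that $\beta(\Theta)=+\infty$. Moreover, this bound is better than Jarník's bound $\beta(\Theta)\ge\alpha(\Theta)^{3/2}-3\alpha(\Theta)$ for all values of $\alpha(\Theta)$: for every real $\alpha\ge 3$, $$\alpha\,g_2(\alpha)>\alpha^{3/2}-3\alpha .$$ -/

import Mathlib

open Filter

noncomputable section

namespace Diophantine

/-- Distance `||x||` from a real number to the nearest integer. -/
def distInt (x : ℝ) : ℝ := |x - round x|

/-- The `j`-th linear form `L_j(x) = ∑ i, θ_j^i x_i` of the `n × m` matrix `Θ`. -/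
def linForm {n m : ℕ} (Θ : Matrix (Fin n) (Fin m) ℝ) (j : Fin n) (x : Fin m → ℤ) : ℝ :=
  ∑ i, Θ j i * (x i : ℝ)

/-- `ζ(x) = max_j ||L_j(x)||`. -/
def zeta {n m : ℕ} (Θ : Matrix (Fin n) (Fin m) ℝ) (x : Fin m → ℤ) : ℝ :=
  ⨆ j, distInt (linForm Θ j x)

/-- `ψ_Θ(t) = min { max_j ||L_j(x)|| : x ∈ ℤ^m, 0 < max_i |x_i| ≤ t }`.
Here `‖x‖` is the maximum norm on `Fin m → ℤ`. For `t ≥ 1` (and `m ≥ 1`) the set is finite and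
nonempty, so the infimum is a minimum; only large `t` matter below. -/
def psi {n m : ℕ} (Θ : Matrix (Fin n) (Fin m) ℝ) (t : ℝ) : ℝ :=
  sInf (zeta Θ '' {x : Fin m → ℤ | 0 < ‖x‖ ∧ ‖x‖ ≤ t})

/-- The uniform exponent `α(Θ)`, a supremum in the extended reals (`⊤` is allowed). The `limsup`
is taken in the extended reals too. -/
def uniformExponent {n m : ℕ} (Θ : Matrix (Fin n) (Fin m) ℝ) : EReal :=
  sSup {e : EReal | ∃ γ : ℝ, 0 < γ ∧ e = (γ : EReal) ∧
    limsup (fun t : ℝ => ((t ^ γ * psi Θ t : ℝ) : EReal)) atTop < ⊤}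

/-- The individual exponent `β(Θ)`, a supremum in the extended reals (`⊤` is allowed). -/
def individualExponent {n m : ℕ} (Θ : Matrix (Fin n) (Fin m) ℝ) : EReal :=
  sSup {e : EReal | ∃ γ : ℝ, 0 < γ ∧ e = (γ : EReal) ∧
    liminf (fun t : ℝ => ((t ^ γ * psi Θ t : ℝ) : EReal)) atTop < ⊤}

/-- `g₂(α) = √(α + 1/α² - 7/4) + 1/α - 1/2`, used for `α ≥ 3`. -/
def g2 (a : ℝ) : ℝ := Real.sqrt (a + 1 / a ^ 2 - 7 / 4) + 1 / a - 1 / 2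

end Diophantine

end

/-! Let `z n` be the best approximations, L_n the absolute value of the form at `z n`, and X_n the
height of `z n`. If γ lies below the uniform exponent and b above the individual one, then L_n ≪
X_{n+1}^{-γ} and L_n ≥ X_n^{-b} for large n. The aim is γ²(γ-1) ≤ γb + b² (`exponent_inequality`).

Two geometric facts are played against each other. Four independent integer points have determinant
at least 1 in absolute value, which gives 1 ≪ L_i X_{i+1} X_{i+2} X_{k+2} (`quadruple_bound`). The
product L_n X_{n+1} stays within constant factors as long as consecutive approximations remain in
one plane (`product_le_of_mem_plane`). Since this product tends to 0, the planes keep changing, and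
`exists_quadruple` finds independent points of indices i, i+1, i+2, k+2 such that those of indices
i+1, i+2, k, k+1 are coplanar. In logarithms everything is linear, and `growth_bound` eliminates all
heights but X_{i+1}, which is unbounded.

If the approximations eventually stay in a proper subspace, such quadruples may be missing, but
`triple_bound` then yields the stronger b ≥ γ(γ-1).

With g = b/γ the inequality reads g² + g ≥ γ - 1. Let γ tend to the uniform exponent; `g2_bound`
finishes. -/

noncomputable section

namespace Diophantine

/-! ### Integer points, the form and the height -/

/-- The real vector underlying an integer vector. -/
def toReal (z : Fin 4 → ℤ) : Fin 4 → ℝ := fun i => (z i : ℝ)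

/-- The homogeneous linear form `a₀ + ∑ θ i * a (i + 1)`. -/
def form (θ : Fin 3 → ℝ) : (Fin 4 → ℝ) →ₗ[ℝ] ℝ :=
  LinearMap.proj 0 + ∑ i, θ i • LinearMap.proj (Fin.succ i)

/-- The maximum norm of the last three coordinates. -/
def height (a : Fin 4 → ℝ) : ℝ := ‖fun i : Fin 3 => a i.succ‖

lemma form_apply (θ : Fin 3 → ℝ) (a : Fin 4 → ℝ) :
    form θ a = a 0 + ∑ i, θ i * a (Fin.succ i) := by
  simp [form]

lemma toReal_sub (z w : Fin 4 → ℤ) : toReal (z - w) = toReal z - toReal w := by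
  ext i; simp [toReal]

lemma toReal_zsmul (p : ℤ) (z : Fin 4 → ℤ) : toReal (p • z) = (p : ℝ) • toReal z := by
  ext i; simp [toReal]

lemma toReal_zero : toReal 0 = 0 := by
  ext i; simp [toReal]

lemma height_nonneg (a : Fin 4 → ℝ) : 0 ≤ height a := norm_nonneg _

lemma height_add_le (a b : Fin 4 → ℝ) : height (a + b) ≤ height a + height b :=
  norm_add_le (fun i : Fin 3 => a i.succ) (fun i : Fin 3 => b i.succ)

lemma height_smul (c : ℝ) (a : Fin 4 → ℝ) : height (c • a) = |c| * height a :=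
  norm_smul c (fun i : Fin 3 => a i.succ)

lemma height_neg (a : Fin 4 → ℝ) : height (-a) = height a :=
  norm_neg (fun i : Fin 3 => a i.succ)

lemma abs_le_height (a : Fin 4 → ℝ) (i : Fin 3) : |a i.succ| ≤ height a :=
  norm_le_pi_norm (fun i : Fin 3 => a i.succ) i

lemma height_toReal_cons (y : ℤ) (x : Fin 3 → ℤ) : height (toReal (Fin.cons y x)) = ‖x‖ := by
  simp only [height, toReal, Fin.cons_succ, Pi.norm_def, nnnorm, Int.norm_cast_real]

/-- Only finitely many integer vectors have bounded height and bounded value of the form. -/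
lemma finite_bounded (θ : Fin 3 → ℝ) (M K : ℝ) :
    {z : Fin 4 → ℤ | height (toReal z) ≤ M ∧ |form θ (toReal z)| ≤ K}.Finite := by
  refine (Set.finite_Icc (fun _ : Fin 4 => -(|⌈M⌉| + |⌈K + ∑ i, |θ i| * M⌉|))
    (fun _ : Fin 4 => (|⌈M⌉| + |⌈K + ∑ i, |θ i| * M⌉|))).subset ?_
  rintro z ⟨h1, h2⟩
  have key : ∀ i, |z i| ≤ |⌈M⌉| + |⌈K + ∑ i, |θ i| * M⌉| := by
    intro i
    refine Fin.cases ?_ (fun j => ?_) i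
    · have h3 : |(z 0 : ℝ)| ≤ K + ∑ i, |θ i| * M := by
        have h4 : (z 0 : ℝ) = form θ (toReal z) - ∑ i, θ i * toReal z (Fin.succ i) := by
          rw [form_apply]; simp [toReal]
        rw [h4]
        refine (abs_sub _ _).trans (add_le_add h2 ?_)
        refine (Finset.abs_sum_le_sum_abs _ _).trans (Finset.sum_le_sum fun i _ => ?_)
        rw [abs_mul]
        exact mul_le_mul_of_nonneg_left ((abs_le_height _ i).trans h1) (abs_nonneg _)
      have h5 : |z 0| ≤ ⌈K + ∑ i, |θ i| * M⌉ := by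
        have := h3.trans (Int.le_ceil _)
        exact_mod_cast this
      have := le_abs_self ⌈K + ∑ i, |θ i| * M⌉
      have := abs_nonneg ⌈M⌉
      linarith
    · have h3 : |(z j.succ : ℝ)| ≤ M := (abs_le_height (toReal z) j).trans h1
      have h5 : |z j.succ| ≤ ⌈M⌉ := by
        have := h3.trans (Int.le_ceil _)
        exact_mod_cast this
      have := le_abs_self ⌈M⌉
      have := abs_nonneg ⌈K + ∑ i, |θ i| * M⌉
      linarith
  exact ⟨fun i => (abs_le.1 (key i)).1, fun i => (abs_le.1 (key i)).2⟩

/-- An integer vector that is not zero but has height zero takes a value at least one. -/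
lemma one_le_abs_form_of_height_eq_zero (θ : Fin 3 → ℝ) {z : Fin 4 → ℤ} (hz : z ≠ 0)
    (h : height (toReal z) ≤ 0) : 1 ≤ |form θ (toReal z)| := by
  have h0 : ∀ i : Fin 3, z i.succ = 0 := fun i => by
    have := (abs_le_height (toReal z) i).trans h
    have : toReal z i.succ = 0 := abs_nonpos_iff.1 this
    simpa [toReal] using this
  have h1 : z 0 ≠ 0 := fun h1 => hz <| by
    ext i
    refine Fin.cases h1 h0 i
  rw [form_apply]
  have h2 : ∀ i : Fin 3, toReal z i.succ = 0 := fun i => by simp [toReal, h0]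
  simp only [h2, mul_zero, Finset.sum_const_zero, add_zero]
  have := Int.one_le_abs h1
  simp only [toReal]
  exact_mod_cast this

/-! ### Dirichlet's theorem and the sequence of best approximations -/

/-- Dirichlet's theorem for one linear form in three variables. -/
lemma dirichlet (θ : Fin 3 → ℝ) (N : ℕ) (hN : 0 < N) :
    ∃ z : Fin 4 → ℤ, 0 < height (toReal z) ∧ height (toReal z) ≤ N ∧
      |form θ (toReal z)| ≤ 1 / (N : ℝ) ^ 3 := by
  have hN' : (0 : ℝ) < (N : ℝ) ^ 3 := by positivity
  let v : (Fin 3 → Fin (N + 1)) → ℝ := fun x => ∑ i, θ i * ((x i : ℕ) : ℝ)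
  let f : (Fin 3 → Fin (N + 1)) → ℕ := fun x => ⌊(N : ℝ) ^ 3 * Int.fract (v x)⌋₊
  -- Pigeonhole: (N + 1)³ points have their fractional parts in N³ intervals of length 1 / N³.
  obtain ⟨x, -, y, -, hxy, hf⟩ := Finset.exists_ne_map_eq_of_card_lt_of_maps_to
    (s := (Finset.univ : Finset (Fin 3 → Fin (N + 1)))) (t := Finset.range (N ^ 3)) (f := f)
    (by simp; exact Nat.pow_lt_pow_left (Nat.lt_succ_self N) (by norm_num))
    (by
      intro x _
      simp only [Finset.coe_range, Set.mem_Iio, f]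
      rw [Nat.floor_lt (by positivity)]
      push_cast
      exact mul_lt_of_lt_one_right hN' (Int.fract_lt_one _))
  refine ⟨Fin.cons (-(⌊v x⌋ - ⌊v y⌋)) (fun i => ((x i : ℕ) : ℤ) - ((y i : ℕ) : ℤ)), ?_, ?_, ?_⟩
  · rw [height_toReal_cons, norm_pos_iff]
    intro h
    refine hxy (funext fun i => Fin.ext ?_)
    have := congrFun h i
    simp only [Pi.zero_apply] at this
    omega
  · rw [height_toReal_cons, pi_norm_le_iff_of_nonneg (by positivity)]
    intro i
    rw [Int.norm_eq_abs]
    have h1 := (x i).is_le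
    have h2 := (y i).is_le
    have : |((x i : ℕ) : ℤ) - ((y i : ℕ) : ℤ)| ≤ (N : ℤ) := by rw [abs_le]; omega
    exact_mod_cast this
  · have h1 : form θ (toReal (Fin.cons (-(⌊v x⌋ - ⌊v y⌋))
        (fun i => ((x i : ℕ) : ℤ) - ((y i : ℕ) : ℤ)))) = Int.fract (v x) - Int.fract (v y) := by
      rw [form_apply]
      simp only [toReal, Fin.cons_zero, Fin.cons_succ, Int.fract, v]
      push_cast
      simp only [mul_sub, Finset.sum_sub_distrib]
      ring
    rw [h1, le_div_iff₀ hN', ← abs_of_pos hN', ← abs_mul, sub_mul,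
      mul_comm, mul_comm (Int.fract (v y))]
    have h2 : ∀ x, ⌊(N : ℝ) ^ 3 * Int.fract (v x)⌋ = (f x : ℤ) := fun x =>
      (Int.natCast_floor_eq_floor (by positivity)).symm
    exact (Int.abs_sub_lt_one_of_floor_eq_floor (by rw [h2, h2, hf])).le

/-- Vectors of positive height take arbitrarily small values. -/
lemma exists_small (θ : Fin 3 → ℝ) {K : ℝ} (hK : 0 < K) :
    ∃ z : Fin 4 → ℤ, 0 < height (toReal z) ∧ |form θ (toReal z)| < K := by
  obtain ⟨n, hn⟩ := exists_nat_gt (1 / K)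
  have hn0 : (0 : ℝ) < n := (by positivity : 0 < 1 / K).trans hn
  have hn1 : 0 < n := by exact_mod_cast hn0
  obtain ⟨z, h1, -, h3⟩ := dirichlet θ n hn1
  refine ⟨z, h1, h3.trans_lt ?_⟩
  have h4 : (1 : ℝ) ≤ n := by exact_mod_cast hn1
  have h5 : (n : ℝ) ≤ (n : ℝ) ^ 3 := le_self_pow₀ h4 (by norm_num)
  rw [div_lt_iff₀ (by positivity)]
  rw [div_lt_iff₀ hK] at hn
  nlinarith

/-- Among the vectors of positive height with value less than `K`, there is one of minimal height,
and with minimal value for that height. -/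
lemma exists_next (θ : Fin 3 → ℝ) {K : ℝ} (hK : 0 < K) (hK1 : K ≤ 1) :
    ∃ z : Fin 4 → ℤ, 0 < height (toReal z) ∧ |form θ (toReal z)| < K ∧
      (∀ w : Fin 4 → ℤ, w ≠ 0 → height (toReal w) < height (toReal z) →
        K ≤ |form θ (toReal w)|) ∧
      (∀ w : Fin 4 → ℤ, w ≠ 0 → height (toReal w) ≤ height (toReal z) →
        |form θ (toReal z)| ≤ |form θ (toReal w)|) := by
  obtain ⟨z₀, hz₀, hz₀K⟩ := exists_small θ hK
  set B : Set (Fin 4 → ℤ) := {z | 0 < height (toReal z) ∧ height (toReal z) ≤ height (toReal z₀) ∧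
    |form θ (toReal z)| < K} with hB
  have hBf : B.Finite := (finite_bounded θ (height (toReal z₀)) K).subset
    fun z hz => ⟨hz.2.1, hz.2.2.le⟩
  -- Lexicographic minimum: height first, then the value. The second minimisation makes the heights
  -- strictly increase when the construction is iterated.
  obtain ⟨z₁, hz₁, hmin₁⟩ := Set.exists_min_image B (fun z => height (toReal z)) hBf
    ⟨z₀, hz₀, le_rfl, hz₀K⟩
  obtain ⟨z, ⟨hz, hzh⟩, hmin⟩ := Set.exists_min_image {z ∈ B | height (toReal z) = height (toReal z₁)}
    (fun z => |form θ (toReal z)|) (hBf.subset fun z hz => hz.1) ⟨z₁, hz₁, rfl⟩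
  have hlt : ∀ w : Fin 4 → ℤ, w ≠ 0 → height (toReal w) < height (toReal z) →
      K ≤ |form θ (toReal w)| := by
    intro w hw hwz
    by_contra! hcon
    -- Vectors of height zero lie outside `B`; `K ≤ 1` excludes them.
    rcases (height_nonneg (toReal w)).eq_or_lt with h | h
    · have := one_le_abs_form_of_height_eq_zero θ hw h.symm.le
      linarith
    · have := hmin₁ w ⟨h, hwz.le.trans hz.2.1, hcon⟩
      linarith
  refine ⟨z, hz.1, hz.2.2, hlt, fun w hw hwz => ?_⟩
  rcases hwz.lt_or_eq with h | h
  · exact hz.2.2.le.trans (hlt w hw h)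
  · by_contra! hcon
    have := hmin w ⟨⟨h ▸ hz.1, h ▸ hz.2.1, hcon.trans hz.2.2⟩, h.trans hzh⟩
    linarith

/-- A sequence of best approximations of the form with coefficients `θ`. -/
structure IsBestSeq (θ : Fin 3 → ℝ) (z : ℕ → Fin 4 → ℤ) : Prop where
  height_pos : ∀ n, 0 < height (toReal (z n))
  form_pos : ∀ n, 0 < |form θ (toReal (z n))|
  form_lt : ∀ n, |form θ (toReal (z (n + 1)))| < |form θ (toReal (z n))|
  height_lt : ∀ n, height (toReal (z n)) < height (toReal (z (n + 1)))
  le_form : ∀ n w, w ≠ 0 → height (toReal w) < height (toReal (z (n + 1))) →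
    |form θ (toReal (z n))| ≤ |form θ (toReal w)|

lemma ne_zero_of_height_pos {z : Fin 4 → ℤ} (h : 0 < height (toReal z)) : z ≠ 0 := by
  rintro rfl
  have : height (toReal 0) = 0 := by
    rw [toReal_zero]; exact norm_zero
  linarith

lemma exists_isBestSeq (θ : Fin 3 → ℝ)
    (hθ : ∀ z : Fin 4 → ℤ, z ≠ 0 → form θ (toReal z) ≠ 0) : ∃ z, IsBestSeq θ z := by
  -- The invariant of the iteration: the bound 1 lets `exists_next` be applied again, and minimality
  -- up to the own height gives `height_lt`.
  let P : Type := {z : Fin 4 → ℤ // 0 < height (toReal z) ∧ |form θ (toReal z)| ≤ 1 ∧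
    ∀ w : Fin 4 → ℤ, w ≠ 0 → height (toReal w) ≤ height (toReal z) →
        |form θ (toReal z)| ≤ |form θ (toReal w)|}
  have hstep : ∀ z : P, ∃ z' : P, |form θ (toReal z'.1)| < |form θ (toReal z.1)| ∧
      ∀ w : Fin 4 → ℤ, w ≠ 0 → height (toReal w) < height (toReal z'.1) →
        |form θ (toReal z.1)| ≤ |form θ (toReal w)| := by
    rintro ⟨z, h1, h2, h3⟩
    obtain ⟨z', h4, h5, h6, h7⟩ :=
      exists_next θ (abs_pos.2 (hθ z (ne_zero_of_height_pos h1))) h2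
    exact ⟨⟨z', h4, h5.le.trans h2, h7⟩, h5, h6⟩
  choose f hf1 hf2 using hstep
  obtain ⟨z₀, h4, h5, h6, h7⟩ := exists_next θ one_pos le_rfl
  let s : ℕ → P := fun n => f^[n] ⟨z₀, h4, h5.le, h7⟩
  have hs : ∀ n, s (n + 1) = f (s n) := fun n => Function.iterate_succ_apply' f n _
  have hlt : ∀ n, |form θ (toReal (s (n + 1)).1)| < |form θ (toReal (s n).1)| := fun n => by
    rw [hs]; exact hf1 _
  refine ⟨fun n => (s n).1, fun n => (s n).2.1,
    fun n => abs_pos.2 (hθ _ (ne_zero_of_height_pos (s n).2.1)), hlt, fun n => ?_, fun n => ?_⟩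
  · by_contra! hcon
    have := (s n).2.2.2 _ (ne_zero_of_height_pos (s (n + 1)).2.1) hcon
    exact absurd (hlt n) this.not_gt
  · simp only [hs]; exact hf2 _

namespace IsBestSeq

variable {θ : Fin 3 → ℝ} {z : ℕ → Fin 4 → ℤ}

lemma strictMono_height (h : IsBestSeq θ z) : StrictMono fun n => height (toReal (z n)) :=
  strictMono_nat_of_lt_succ h.height_lt

lemma strictAnti_form (h : IsBestSeq θ z) : StrictAnti fun n => |form θ (toReal (z n))| :=
  strictAnti_nat_of_succ_lt h.form_lt

lemma tendsto_height (h : IsBestSeq θ z) :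
    Tendsto (fun n => height (toReal (z n))) atTop atTop := by
  refine tendsto_atTop_atTop_of_monotone h.strictMono_height.monotone fun M => ?_
  by_contra! hcon
  refine Set.infinite_range_of_injective (f := z) (fun m n hmn => ?_)
    ((finite_bounded θ M |form θ (toReal (z 0))|).subset ?_)
  · exact h.strictMono_height.injective (by simp [hmn])
  · rintro _ ⟨n, rfl⟩
    exact ⟨(hcon n).le, h.strictAnti_form.antitone (Nat.zero_le n)⟩

end IsBestSeq

/-! ### Planes of consecutive best approximations -/

/-- The combination of `a` and `b` on which the form vanishes. -/
def wedge (θ : Fin 3 → ℝ) (a b : Fin 4 → ℝ) : Fin 4 → ℝ := form θ a • b - form θ b • a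

lemma height_sub_le (a b : Fin 4 → ℝ) : height (a - b) ≤ height a + height b := by
  rw [sub_eq_add_neg, ← height_neg b]; exact height_add_le _ _

lemma height_wedge_le (θ : Fin 3 → ℝ) (a b : Fin 4 → ℝ) :
    height (wedge θ a b) ≤ |form θ a| * height b + |form θ b| * height a := by
  rw [wedge, ← height_smul, ← height_smul]
  exact height_sub_le _ _

lemma wedge_combination (θ : Fin 3 → ℝ) (a b : Fin 4 → ℝ) (p q r s : ℝ) :
    wedge θ (p • a + q • b) (r • a + s • b) = (p * s - q * r) • wedge θ a b := by
  ext i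
  simp [wedge]
  ring

/-- The plane spanned by two vectors of a sequence of integer vectors. -/
def plane (z : ℕ → Fin 4 → ℤ) (n : ℕ) : Submodule ℝ (Fin 4 → ℝ) :=
  Submodule.span ℝ {toReal (z n), toReal (z (n + 1))}

lemma plane_eq_span_range (z : ℕ → Fin 4 → ℤ) (n : ℕ) :
    plane z n = Submodule.span ℝ (Set.range ![toReal (z n), toReal (z (n + 1))]) := by
  rw [plane, Matrix.range_cons_cons_empty]

lemma mem_plane_left (z : ℕ → Fin 4 → ℤ) (n : ℕ) : toReal (z n) ∈ plane z n :=
  Submodule.subset_span (by simp)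

lemma mem_plane_right (z : ℕ → Fin 4 → ℤ) (n : ℕ) : toReal (z (n + 1)) ∈ plane z n :=
  Submodule.subset_span (by simp)

namespace IsBestSeq

variable {θ : Fin 3 → ℝ} {z : ℕ → Fin 4 → ℤ}

/-- A vector with a value smaller than that of `z n` is at least as high as `z (n + 1)`. -/
lemma le_height (h : IsBestSeq θ z) (n : ℕ) {w : Fin 4 → ℤ} (hw : w ≠ 0)
    (hlt : |form θ (toReal w)| < |form θ (toReal (z n))|) :
    height (toReal (z (n + 1))) ≤ height (toReal w) := by
  by_contra! hcon
  exact absurd hlt (h.le_form n w hw hcon).not_gt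

/-- With `wedge_upper`, this makes the height of the wedge a substitute for L_n X_{n+1} that
transforms by determinants within a plane. The triangle inequality alone fails when L_{n+1} X_n is
close to L_n X_{n+1}; a second estimate, through `z (n + 1) - e • z n`, is added to compensate. -/
lemma wedge_lower (h : IsBestSeq θ z) (n : ℕ) :
    |form θ (toReal (z n))| * height (toReal (z (n + 1))) ≤
      2 * height (wedge θ (toReal (z n)) (toReal (z (n + 1)))) := by
  have hA := h.form_pos n
  have hB := h.form_pos (n + 1)
  have hlt := h.form_lt n
  have hX := h.height_lt n
  have hX0 := h.height_pos n
  -- The sign `e` makes the two values partly cancel, so `z (n + 1) - e • z n` has a value below L_n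
  -- and hence height at least X_{n+1}.
  obtain ⟨e, he, hab⟩ : ∃ e : ℤ, |(e : ℝ)| = 1 ∧
      |(e : ℝ) * form θ (toReal (z n)) - form θ (toReal (z (n + 1)))| =
        |form θ (toReal (z n))| - |form θ (toReal (z (n + 1)))| := by
    revert hA hB hlt
    generalize form θ (toReal (z n)) = A
    generalize form θ (toReal (z (n + 1))) = B
    intro hA hB hlt
    rcases le_total 0 A with hA' | hA' <;> rcases le_total 0 B with hB' | hB' <;>
      simp only [abs_of_nonneg, abs_of_nonpos, hA', hB'] at hlt ⊢
    · exact ⟨1, by simp, by rw [abs_of_nonneg] <;> push_cast <;> linarith⟩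
    · exact ⟨-1, by simp, by rw [abs_of_nonpos] <;> push_cast <;> linarith⟩
    · exact ⟨-1, by simp, by rw [abs_of_nonneg] <;> push_cast <;> linarith⟩
    · exact ⟨1, by simp, by rw [abs_of_nonpos] <;> push_cast <;> linarith⟩
  have hw : toReal (z (n + 1) - e • z n) = toReal (z (n + 1)) - (e : ℝ) • toReal (z n) := by
    rw [toReal_sub, toReal_zsmul]
  have hwX : height (toReal (z (n + 1))) ≤ height (toReal (z (n + 1) - e • z n)) := by
    refine h.le_height n (fun h0 => ?_) ?_
    · rw [h0, toReal_zero, eq_comm, sub_eq_zero] at hw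
      rw [hw, height_smul, he, one_mul] at hX
      exact lt_irrefl _ hX
    · rw [hw, map_sub, map_smul, smul_eq_mul, abs_sub_comm, hab]
      linarith
  have b1 : |form θ (toReal (z n))| * height (toReal (z (n + 1))) ≤
      height (wedge θ (toReal (z n)) (toReal (z (n + 1)))) +
        |form θ (toReal (z (n + 1)))| * height (toReal (z n)) := by
    rw [← height_smul, ← height_smul]
    refine le_trans (le_of_eq ?_) (height_add_le _ _)
    rw [wedge, sub_add_cancel]
  have b2 : |form θ (toReal (z n))| * height (toReal (z (n + 1) - e • z n)) ≤
      height (wedge θ (toReal (z n)) (toReal (z (n + 1)))) +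
        (|form θ (toReal (z n))| - |form θ (toReal (z (n + 1)))|) * height (toReal (z n)) := by
    rw [← hab, ← height_smul, ← height_smul]
    refine le_trans (le_of_eq ?_) (height_sub_le _ _)
    rw [wedge, hw]
    congr 1
    module
  have b3 := mul_le_mul_of_nonneg_left hwX hA.le
  have b4 := mul_le_mul_of_nonneg_left hX.le hA.le
  linarith

lemma wedge_upper (h : IsBestSeq θ z) (n : ℕ) :
    height (wedge θ (toReal (z n)) (toReal (z (n + 1)))) ≤
      2 * (|form θ (toReal (z n))| * height (toReal (z (n + 1)))) := by
  have h1 := height_wedge_le θ (toReal (z n)) (toReal (z (n + 1)))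
  have h2 : |form θ (toReal (z (n + 1)))| * height (toReal (z n)) ≤
      |form θ (toReal (z n))| * height (toReal (z (n + 1))) :=
    mul_le_mul (h.form_lt n).le (h.height_lt n).le (h.height_pos n).le (abs_nonneg _)
  linarith

lemma wedge_height_pos (h : IsBestSeq θ z) (n : ℕ) :
    0 < height (wedge θ (toReal (z n)) (toReal (z (n + 1)))) := by
  have h1 := h.wedge_lower n
  have h2 := mul_pos (h.form_pos n) (h.height_pos (n + 1))
  linarith

/-- Consecutive best approximations generate the lattice of integer points of their plane. -/
lemma exists_int_combination (h : IsBestSeq θ z) (n : ℕ) {w : Fin 4 → ℤ}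
    (hw : toReal w ∈ plane z n) :
    ∃ p q : ℤ, toReal w = (p : ℝ) • toReal (z n) + (q : ℝ) • toReal (z (n + 1)) := by
  obtain ⟨s, t, hst⟩ := Submodule.mem_span_pair.1 hw
  -- The remainder after rounding has coefficients at most 1/2, so its value is below L_n and its
  -- height below X_{n+1}. By minimality it vanishes.
  refine ⟨round s, round t, ?_⟩
  by_contra hne
  set w' : Fin 4 → ℤ := w - round s • z n - round t • z (n + 1) with hw'
  have hcast : toReal w' = (s - round s) • toReal (z n) + (t - round t) • toReal (z (n + 1)) := by
    rw [hw', toReal_sub, toReal_sub, toReal_zsmul, toReal_zsmul, ← hst]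
    module
  have h0 : w' ≠ 0 := by
    intro h0
    apply hne
    have := congrArg toReal h0
    rw [hw', toReal_sub, toReal_sub, toReal_zsmul, toReal_zsmul, toReal_zero, sub_sub,
      sub_eq_zero] at this
    exact this
  have hs := abs_sub_round s
  have ht := abs_sub_round t
  have hA := h.form_pos n
  have hB := h.form_pos (n + 1)
  have hlt := h.form_lt n
  have hX := h.height_lt n
  have hX0 := h.height_pos n
  have h1 : |form θ (toReal w')| < |form θ (toReal (z n))| := by
    rw [hcast, map_add, map_smul, map_smul, smul_eq_mul, smul_eq_mul]
    refine (abs_add_le _ _).trans_lt ?_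
    rw [abs_mul, abs_mul]
    nlinarith
  have h2 := h.le_height n h0 h1
  have h3 : height (toReal w') < height (toReal (z (n + 1))) := by
    rw [hcast]
    refine (height_add_le _ _).trans_lt ?_
    rw [height_smul, height_smul]
    nlinarith
  linarith

/-- The products `|L(z n)| * X (n + 1)` are comparable along a plane. -/
lemma product_le_of_mem_plane (h : IsBestSeq θ z) {n m : ℕ} (h1 : toReal (z m) ∈ plane z n)
    (h2 : toReal (z (m + 1)) ∈ plane z n) :
    |form θ (toReal (z n))| * height (toReal (z (n + 1))) ≤
      4 * (|form θ (toReal (z m))| * height (toReal (z (m + 1)))) := by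
  obtain ⟨p, q, hpq⟩ := h.exists_int_combination n h1
  obtain ⟨r, s, hrs⟩ := h.exists_int_combination n h2
  -- The change of pair multiplies the wedge by an integer determinant, nonzero because the wedge of
  -- `z m` and `z (m + 1)` is nonzero.
  have hV : height (wedge θ (toReal (z m)) (toReal (z (m + 1)))) =
      |((p * s - q * r : ℤ) : ℝ)| * height (wedge θ (toReal (z n)) (toReal (z (n + 1)))) := by
    rw [hpq, hrs, wedge_combination, height_smul]
    push_cast
    rfl
  have hd : p * s - q * r ≠ 0 := by
    intro h0
    have := h.wedge_height_pos m
    rw [hV, h0] at this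
    simp at this
  have hd1 : (1 : ℝ) ≤ |((p * s - q * r : ℤ) : ℝ)| := by exact_mod_cast Int.one_le_abs hd
  have h3 := h.wedge_lower n
  have h4 := h.wedge_upper m
  have h5 := h.wedge_height_pos n
  nlinarith

lemma linearIndependent_pair (h : IsBestSeq θ z) (n : ℕ) :
    LinearIndependent ℝ ![toReal (z n), toReal (z (n + 1))] := by
  rw [LinearIndependent.pair_iff]
  intro s t hst
  have hV := h.wedge_height_pos n
  have e1 : wedge θ (s • toReal (z n) + t • toReal (z (n + 1)))
      ((0 : ℝ) • toReal (z n) + (1 : ℝ) • toReal (z (n + 1))) =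
      s • wedge θ (toReal (z n)) (toReal (z (n + 1))) := by
    rw [wedge_combination]; congr 1; ring
  have e2 : wedge θ ((1 : ℝ) • toReal (z n) + (0 : ℝ) • toReal (z (n + 1)))
      (s • toReal (z n) + t • toReal (z (n + 1))) =
      t • wedge θ (toReal (z n)) (toReal (z (n + 1))) := by
    rw [wedge_combination]; congr 1; ring
  have hz : ∀ a, height (wedge θ 0 a) = 0 ∧ height (wedge θ a 0) = 0 := fun a => by
    constructor
    · simp only [wedge, map_zero, zero_smul, smul_zero, sub_zero]; exact norm_zero
    · simp only [wedge, map_zero, zero_smul, smul_zero, sub_zero]; exact norm_zero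
  rw [hst] at e1 e2
  have e1' := (hz _).1.symm.trans (congrArg height e1)
  have e2' := (hz _).2.symm.trans (congrArg height e2)
  rw [height_smul] at e1' e2'
  constructor
  · have := mul_eq_zero.1 e1'.symm
    simpa [hV.ne'] using this
  · have := mul_eq_zero.1 e2'.symm
    simpa [hV.ne'] using this

lemma finrank_plane (h : IsBestSeq θ z) (n : ℕ) : Module.finrank ℝ (plane z n) = 2 := by
  have := finrank_span_eq_card (h.linearIndependent_pair n)
  rwa [← plane_eq_span_range, Fintype.card_fin] at this

lemma plane_eq_of_mem (h : IsBestSeq θ z) {n m : ℕ} (h1 : toReal (z m) ∈ plane z n)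
    (h2 : toReal (z (m + 1)) ∈ plane z n) : plane z m = plane z n := by
  refine Submodule.eq_of_le_of_finrank_eq ?_ (by rw [h.finrank_plane, h.finrank_plane])
  rw [plane, Submodule.span_le]
  rintro _ (rfl | rfl)
  exacts [h1, h2]

end IsBestSeq

/-! ### Determinants of integer points -/

/-- A determinant bound: rows of height at most `X r` on which the form is at most `c * X r`. -/
lemma abs_det_le (θ : Fin 3 → ℝ) (a : Matrix (Fin 4) (Fin 4) ℝ) (X : Fin 4 → ℝ) (c : ℝ)
    (hX : ∀ r, 0 < X r) (hc : 0 < c) (h1 : ∀ r, height (a r) ≤ X r)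
    (h2 : ∀ r, |form θ (a r)| ≤ c * X r) : |a.det| ≤ 24 * (c * ∏ r, X r) := by
  -- A unimodular column operation puts the values of the form in the first column. Scaling rows by
  -- `X r` and the first column by `c` leaves entries in [-1, 1], whose determinant is at most 4! =
  -- 24.
  set E : Matrix (Fin 4) (Fin 4) ℝ :=
    Matrix.of fun r => (Fin.cons (form θ (a r)) (fun i => a r i.succ) : Fin 4 → ℝ) with hE
  have hdet : a.det = E.det := by
    set B : Matrix (Fin 4) (Fin 4) ℝ := Matrix.of ![![1, 0, 0, 0], ![θ 0, 1, 0, 0],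
      ![θ 1, 0, 1, 0], ![θ 2, 0, 0, 1]] with hB
    have hBd : B.det = 1 := by
      simp [hB, Matrix.det_succ_row_zero, Fin.sum_univ_succ]
    have : E = a * B := by
      ext r j
      rw [Matrix.mul_apply]
      fin_cases j <;> simp [hE, hB, form_apply, Fin.sum_univ_succ]
      · ring
      · rfl
      · rfl
    rw [this, Matrix.det_mul, hBd, mul_one]
  set N : Matrix (Fin 4) (Fin 4) ℝ :=
    Matrix.of fun r => (Fin.cons (form θ (a r) / (c * X r)) (fun i => a r i.succ / X r)
      : Fin 4 → ℝ) with hN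
  set d : Fin 4 → ℝ := Fin.cons c (fun _ => 1) with hd
  have hEN : E = Matrix.of fun r j => X r * (Matrix.of fun r j => d j * N r j) r j := by
    ext r j
    have hXr := (hX r).ne'
    refine Fin.cases ?_ (fun j => ?_) j
    · simp [hE, hN, hd]; field_simp
    · simp [hE, hN, hd]; field_simp
  have hNb : |N.det| ≤ 24 := by
    have := Matrix.det_le (A := N) (abv := AbsoluteValue.abs) (x := 1) (by
      intro r j
      have hXr := hX r
      simp only [AbsoluteValue.abs_apply]
      refine Fin.cases ?_ (fun j => ?_) j
      · simp only [hN, Matrix.of_apply, Fin.cons_zero]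
        rw [abs_div, abs_of_pos (mul_pos hc hXr), div_le_one (mul_pos hc hXr)]
        exact h2 r
      · simp only [hN, Matrix.of_apply, Fin.cons_succ]
        rw [abs_div, abs_of_pos hXr, div_le_one hXr]
        exact (abs_le_height _ j).trans (h1 r))
    simpa [Nat.factorial] using this
  rw [hdet, hEN, Matrix.det_mul_column, Matrix.det_mul_row, abs_mul, abs_mul,
    abs_of_pos (Finset.prod_pos fun r _ => hX r)]
  have hdc : |∏ i, d i| = c := by
    simp [hd, Fin.prod_univ_succ, abs_of_pos hc]
  rw [hdc]
  have hP : 0 < ∏ r, X r := Finset.prod_pos fun r _ => hX r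
  have := mul_le_mul_of_nonneg_left hNb (mul_pos hc hP).le
  linarith

/-- A nonsingular matrix with integer rows has determinant at least one in absolute value. -/
lemma one_le_abs_det (r : Fin 4 → Fin 4 → ℤ)
    (h : LinearIndependent ℝ fun i => toReal (r i)) :
    1 ≤ |(Matrix.of fun i => toReal (r i)).det| := by
  have h1 : IsUnit (Matrix.of fun i => toReal (r i)) :=
    Matrix.linearIndependent_rows_iff_isUnit.1 h
  have h2 : (Matrix.of fun i => toReal (r i)).det = (((Matrix.of r).det : ℤ) : ℝ) := by
    rw [Int.cast_det]
    rfl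
  have h3 := ((Matrix.isUnit_iff_isUnit_det _).1 h1).ne_zero
  rw [h2] at h3 ⊢
  have h4 : (Matrix.of r).det ≠ 0 := by exact_mod_cast h3
  exact_mod_cast Int.one_le_abs h4

/-- Four vectors on which a nonzero functional vanishes have determinant zero. -/
lemma det_eq_zero_of_ker (φ : (Fin 4 → ℝ) →ₗ[ℝ] ℝ) (hφ : φ ≠ 0) (a : Matrix (Fin 4) (Fin 4) ℝ)
    (h : ∀ i, φ (a i) = 0) : a.det = 0 := by
  rw [← Matrix.exists_mulVec_eq_zero_iff]
  refine ⟨fun j => φ (Pi.single j 1), fun h0 => hφ ?_, ?_⟩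
  · refine LinearMap.pi_ext' fun j => LinearMap.ext_ring ?_
    simpa using congrFun h0 j
  · ext i
    rw [Pi.zero_apply, ← h i, φ.pi_apply_eq_sum_univ (a i)]
    simp only [Matrix.mulVec, dotProduct, smul_eq_mul]
    refine Finset.sum_congr rfl fun j _ => ?_
    congr 2
    ext k
    simp [Pi.single_apply, eq_comm]

/-! ### Independent triples and quadruples -/

namespace IsBestSeq

variable {θ : Fin 3 → ℝ} {z : ℕ → Fin 4 → ℤ}

/-- Within a fixed plane the products L_m X_{m+1} are bounded below, against their convergence to 0.
-/
lemma exists_notMem_plane (h : IsBestSeq θ z)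
    (h0 : Tendsto (fun n => |form θ (toReal (z n))| * height (toReal (z (n + 1)))) atTop (nhds 0))
    (n : ℕ) : ∃ m ≥ n, toReal (z m) ∉ plane z n := by
  by_contra! hcon
  have h1 : ∀ᶠ m in atTop, |form θ (toReal (z n))| * height (toReal (z (n + 1))) ≤
      4 * (|form θ (toReal (z m))| * height (toReal (z (m + 1)))) := by
    filter_upwards [eventually_ge_atTop n] with m hm
    exact h.product_le_of_mem_plane (hcon m hm) (hcon (m + 1) (by omega))
  have h2 := ge_of_tendsto (h0.const_mul 4) h1
  have h3 := mul_pos (h.form_pos n) (h.height_pos (n + 1))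
  linarith

lemma exists_triple (h : IsBestSeq θ z)
    (h0 : Tendsto (fun n => |form θ (toReal (z n))| * height (toReal (z (n + 1)))) atTop (nhds 0))
    (n : ℕ) : ∃ i ≥ n, toReal (z (i + 2)) ∉ plane z i := by
  classical
  have hex := h.exists_notMem_plane h0 n
  -- At the first exit `m = i + 2` from the plane, `z i` and `z (i + 1)` still span it.
  obtain ⟨m, ⟨hmn, hm⟩, hmin⟩ : ∃ m, (n ≤ m ∧ toReal (z m) ∉ plane z n) ∧
      ∀ l < m, ¬ (n ≤ l ∧ toReal (z l) ∉ plane z n) :=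
    ⟨Nat.find hex, Nat.find_spec hex, fun l hl => Nat.find_min hex hl⟩
  have hm0 : m ≠ n := by rintro rfl; exact hm (mem_plane_left z _)
  have hm1 : m ≠ n + 1 := by rintro rfl; exact hm (mem_plane_right z _)
  obtain ⟨i, rfl⟩ : ∃ i, m = i + 2 := ⟨m - 2, by omega⟩
  refine ⟨i, by omega, ?_⟩
  have e1 := hmin i (by omega)
  have e2 := hmin (i + 1) (by omega)
  push Not at e1 e2
  rwa [h.plane_eq_of_mem (e1 (by omega)) (e2 (by omega))]

lemma linearIndependent_triple (h : IsBestSeq θ z) {n : ℕ} {w : Fin 4 → ℝ} (hw : w ∉ plane z n) :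
    LinearIndependent ℝ ![w, toReal (z n), toReal (z (n + 1))] := by
  refine linearIndependent_finCons.2 ⟨h.linearIndependent_pair n, ?_⟩
  rwa [← plane_eq_span_range]

/-- Start from an independent triple at `j` with span `S`, and let `k + 2` be the first later index
outside `S`. Let `i` be the last index up to `k` whose point is off the plane of `z k` and `z (k +
1)`. Everything between `i` and `k + 2` is in that plane, so the triple at `i` is independent and
lies in `S`. -/
lemma exists_quadruple (h : IsBestSeq θ z)
    (h0 : Tendsto (fun n => |form θ (toReal (z n))| * height (toReal (z (n + 1)))) atTop (nhds 0))
    (hS : ∀ (S : Submodule ℝ (Fin 4 → ℝ)), S ≠ ⊤ → ∀ N, ∃ n ≥ N, toReal (z n) ∉ S) (N : ℕ) :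
    ∃ i ≥ N, ∃ k > i, toReal (z k) ∈ plane z (i + 1) ∧ toReal (z (k + 1)) ∈ plane z (i + 1) ∧
      LinearIndependent ℝ
        ![toReal (z (k + 2)), toReal (z i), toReal (z (i + 1)), toReal (z (i + 2))] := by
  classical
  obtain ⟨j, hj, hjp⟩ := h.exists_triple h0 N
  set S : Submodule ℝ (Fin 4 → ℝ) :=
    Submodule.span ℝ (Set.range ![toReal (z j), toReal (z (j + 1)), toReal (z (j + 2))]) with hSdef
  have hStop : S ≠ ⊤ := by
    intro hS
    have h1 := finrank_range_le_card (R := ℝ)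
      ![toReal (z j), toReal (z (j + 1)), toReal (z (j + 2))]
    rw [Set.finrank, ← hSdef, hS, finrank_top] at h1
    simp at h1
  have hex := hS S hStop j
  obtain ⟨n, ⟨hnj, hn⟩, hmin⟩ : ∃ m, (j ≤ m ∧ toReal (z m) ∉ S) ∧
      ∀ l < m, ¬ (j ≤ l ∧ toReal (z l) ∉ S) :=
    ⟨Nat.find hex, Nat.find_spec hex, fun l hl => Nat.find_min hex hl⟩
  have hmem : ∀ l, j ≤ l → l < n → toReal (z l) ∈ S := fun l h1 h2 => by
    have := hmin l h2
    push Not at this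
    exact this h1
  have hn0 : n ≠ j := by rintro rfl; exact hn (Submodule.subset_span ⟨0, rfl⟩)
  have hn1 : n ≠ j + 1 := by rintro rfl; exact hn (Submodule.subset_span ⟨1, rfl⟩)
  have hn2 : n ≠ j + 2 := by rintro rfl; exact hn (Submodule.subset_span ⟨2, rfl⟩)
  obtain ⟨k, rfl⟩ : ∃ k, n = k + 2 := ⟨n - 2, by omega⟩
  -- Otherwise the initial triple at `j` would be coplanar. This bound also ensures `j ≤ i`, so the
  -- points from `i` on lie in `S`.
  have hi₀ : ∃ i₀, j ≤ i₀ ∧ i₀ ≤ k ∧ toReal (z i₀) ∉ plane z k := by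
    by_contra! hcon
    have hall : ∀ l, j ≤ l → l ≤ k + 1 → toReal (z l) ∈ plane z k := fun l h1 h2 => by
      rcases Nat.lt_or_ge k l with h3 | h3
      · obtain rfl : l = k + 1 := by omega
        exact mem_plane_right z k
      · exact hcon l h1 h3
    have e := h.plane_eq_of_mem (hall j le_rfl (by omega)) (hall (j + 1) (by omega) (by omega))
    exact hjp (e ▸ hall (j + 2) (by omega) (by omega))
  obtain ⟨i₀, hji₀, hi₀k, hi₀⟩ := hi₀
  set i := Nat.findGreatest (fun l => toReal (z l) ∉ plane z k) k with hi
  have hip : toReal (z i) ∉ plane z k :=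
    Nat.findGreatest_spec (P := fun l => toReal (z l) ∉ plane z k) hi₀k hi₀
  have hile : i₀ ≤ i := Nat.le_findGreatest hi₀k hi₀
  have hik : i ≤ k := Nat.findGreatest_le k
  have hik' : i ≠ k := fun e => hip (e ▸ mem_plane_left z k)
  have hgt : ∀ l, i < l → l ≤ k + 1 → toReal (z l) ∈ plane z k := fun l h1 h2 => by
    rcases Nat.lt_or_ge k l with h3 | h3
    · obtain rfl : l = k + 1 := by omega
      exact mem_plane_right z k
    · simpa using Nat.findGreatest_is_greatest (P := fun l => toReal (z l) ∉ plane z k) h1 h3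
  have hpl : plane z (i + 1) = plane z k :=
    h.plane_eq_of_mem (hgt (i + 1) (by omega) (by omega)) (hgt (i + 2) (by omega) (by omega))
  refine ⟨i, by omega, k, by omega, hpl ▸ mem_plane_left z k, hpl ▸ mem_plane_right z k, ?_⟩
  refine linearIndependent_finCons.2 ⟨h.linearIndependent_triple (hpl ▸ hip), fun hcon => hn ?_⟩
  refine (Submodule.span_le.2 ?_) hcon
  rintro _ ⟨r, rfl⟩
  fin_cases r
  · exact hmem i (by omega) (by omega)
  · exact hmem (i + 1) (by omega) (by omega)
  · exact hmem (i + 2) (by omega) (by omega)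

/-- Values decrease and heights increase, so L_i / X_i serves as the constant `c` of `abs_det_le`
for every row of index at least `i`; it cancels X_i from the product. -/
lemma form_le_ratio_mul (h : IsBestSeq θ z) {i m : ℕ} (him : i ≤ m) :
    |form θ (toReal (z m))| ≤
      |form θ (toReal (z i))| / height (toReal (z i)) * height (toReal (z m)) := by
  have h1 := h.strictAnti_form.antitone him
  have h2 := h.strictMono_height.monotone him
  have h3 := h.height_pos i
  rw [div_mul_eq_mul_div, le_div_iff₀ h3]
  exact mul_le_mul h1 h2 h3.le (abs_nonneg _)

lemma quadruple_bound (h : IsBestSeq θ z) {i k : ℕ} (hik : i < k)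
    (hli : LinearIndependent ℝ
        ![toReal (z (k + 2)), toReal (z i), toReal (z (i + 1)), toReal (z (i + 2))]) :
    1 ≤ 24 * (|form θ (toReal (z i))| * height (toReal (z (i + 1))) *
      height (toReal (z (i + 2))) * height (toReal (z (k + 2)))) := by
  have e : ![toReal (z (k + 2)), toReal (z i), toReal (z (i + 1)), toReal (z (i + 2))] =
      fun r => toReal (z (![k + 2, i, i + 1, i + 2] r)) := by
    ext r; fin_cases r <;> rfl
  rw [e] at hli
  have h1 := one_le_abs_det (fun r => z (![k + 2, i, i + 1, i + 2] r)) hli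
  have h2 := abs_det_le θ (Matrix.of fun r => toReal (z (![k + 2, i, i + 1, i + 2] r)))
    (fun r => height (toReal (z (![k + 2, i, i + 1, i + 2] r))))
    (|form θ (toReal (z i))| / height (toReal (z i))) (fun r => h.height_pos _)
    (div_pos (h.form_pos i) (h.height_pos i)) (fun r => le_rfl)
    (fun r => h.form_le_ratio_mul (by fin_cases r <;> (simp; try omega)))
  refine (h1.trans h2).trans (le_of_eq ?_)
  have h3 := (h.height_pos i).ne'
  simp [Fin.prod_univ_succ]
  field_simp

/-- If the best approximations eventually lie in a proper subspace, then independent triples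
satisfy a stronger estimate. -/
lemma triple_bound (h : IsBestSeq θ z) {S : Submodule ℝ (Fin 4 → ℝ)} (hS : S ≠ ⊤) {N : ℕ}
    (hN : ∀ n ≥ N, toReal (z n) ∈ S) :
    ∃ H : ℝ, 0 < H ∧ ∀ i ≥ N, toReal (z (i + 2)) ∉ plane z i →
      1 ≤ 24 * (|form θ (toReal (z i))| * height (toReal (z (i + 1))) *
        height (toReal (z (i + 2))) * H) := by
  obtain ⟨φ, hφ, hle⟩ := Submodule.exists_le_ker_of_lt_top S hS.lt_top
  have hφz : ∀ n ≥ N, φ (toReal (z n)) = 0 := fun n hn => hle (hN n hn)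
  -- A standard basis vector outside the kernel of `φ` completes the triple to an independent
  -- integer quadruple.
  obtain ⟨m, hm⟩ : ∃ m, φ (toReal (Pi.single m 1)) ≠ 0 := by
    by_contra! hcon
    refine hφ (LinearMap.pi_ext' fun j => LinearMap.ext_ring ?_)
    have e : toReal (Pi.single j 1) = Pi.single j 1 := by
      ext k; by_cases hk : k = j <;> simp [toReal, hk]
    have := hcon j
    rw [e] at this
    simpa using this
  set e : Fin 4 → ℝ := toReal (Pi.single m 1) with he
  -- Chosen so that the form vanishes at `w`. Adding a multiple of `z N` to this row keeps the
  -- determinant, the other three rows and `z N` being in the kernel of `φ`.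
  set c : ℝ := -(form θ e / form θ (toReal (z N))) with hc
  set w : Fin 4 → ℝ := e + c • toReal (z N) with hw
  have hLN : form θ (toReal (z N)) ≠ 0 := abs_pos.1 (h.form_pos N)
  have hLw : form θ w = 0 := by
    rw [hw, map_add, map_smul, smul_eq_mul, hc]
    field_simp
    ring
  refine ⟨height w + 1, by linarith [height_nonneg w], fun i hi hip => ?_⟩
  have hli : LinearIndependent ℝ
      (Fin.cons e ![toReal (z (i + 2)), toReal (z i), toReal (z (i + 1))] :
        Fin 4 → Fin 4 → ℝ) := by
    refine linearIndependent_finCons.2 ⟨h.linearIndependent_triple hip, fun hcon => hm ?_⟩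
    refine LinearMap.mem_ker.1 ((Submodule.span_le.2 ?_) hcon)
    rintro _ ⟨r, rfl⟩
    fin_cases r
    · exact hφz _ (by omega)
    · exact hφz _ (by omega)
    · exact hφz _ (by omega)
  have hrow : (Fin.cons e ![toReal (z (i + 2)), toReal (z i), toReal (z (i + 1))] :
      Fin 4 → Fin 4 → ℝ) = fun r => toReal (![Pi.single m 1, z (i + 2), z i, z (i + 1)] r) := by
    ext r; fin_cases r <;> rfl
  rw [hrow] at hli
  have h1 := one_le_abs_det _ hli
  set A : Matrix (Fin 4) (Fin 4) ℝ :=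
    Matrix.of fun r => toReal (![Pi.single m 1, z (i + 2), z i, z (i + 1)] r) with hA
  have hA0 : A.updateRow 0 e = A := Matrix.updateRow_eq_self A 0
  have hdet : (A.updateRow 0 w).det = A.det := by
    rw [hw, Matrix.det_updateRow_add, Matrix.det_updateRow_smul, hA0,
      det_eq_zero_of_ker φ hφ (A.updateRow 0 (toReal (z N))), mul_zero, add_zero]
    intro r
    fin_cases r
    · simpa using hφz N le_rfl
    · exact hφz (i + 2) (by omega)
    · exact hφz i (by omega)
    · exact hφz (i + 1) (by omega)
  rw [← hdet] at h1
  have hpos := h.height_pos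
  have hw0 := height_nonneg w
  have hc0 := div_pos (h.form_pos i) (h.height_pos i)
  have h2 := abs_det_le θ (A.updateRow 0 w)
    ![height w + 1, height (toReal (z (i + 2))), height (toReal (z i)),
      height (toReal (z (i + 1)))]
    (|form θ (toReal (z i))| / height (toReal (z i)))
    (by
      intro r
      fin_cases r
      · change 0 < height w + 1; linarith
      all_goals exact hpos _)
    hc0
    (by
      intro r
      fin_cases r
      · change height w ≤ height w + 1; linarith
      all_goals exact le_rfl)
    (by
      intro r
      fin_cases r
      · change |form θ w| ≤ _ * (height w + 1)
        rw [hLw, abs_zero]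
        positivity
      · exact h.form_le_ratio_mul (m := i + 2) (by omega)
      · exact h.form_le_ratio_mul (m := i) le_rfl
      · exact h.form_le_ratio_mul (m := i + 1) (by omega))
  refine (h1.trans h2).trans (le_of_eq ?_)
  have h3 := (h.height_pos i).ne'
  simp [Fin.prod_univ_succ]
  field_simp

end IsBestSeq

/-! ### From the geometry to the exponent inequality -/

/-- The multipliers are chosen to cancel `v`, `w` and `w'`; the hypothesis `hbγ` keeps the
multiplier of `h3` nonnegative. -/
lemma growth_bound {γ b C u v w w' : ℝ} (hγ : 1 < γ) (hb : 0 < b) (hbγ : b ≤ γ * (γ - 1))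
    (h1 : (γ - 1) * u ≤ C + v + w') (h2 : (γ - 1) * w ≤ C + b * u - v) (h3 : γ * v ≤ C + b * u)
    (h4 : γ * w' ≤ C + b * w) :
    (γ - 1) * (γ ^ 2 * (γ - 1) - (γ * b + b ^ 2)) * u ≤
      γ ^ 2 * (γ - 1) * C + γ * (γ - 1) * C + γ * b * C + (γ * (γ - 1) - b) * C := by
  have hγ1 : 0 < γ - 1 := by linarith
  have hγ0 : 0 < γ := by linarith
  have e1 := mul_le_mul_of_nonneg_left h1 (by positivity : 0 ≤ γ ^ 2 * (γ - 1))
  have e2 := mul_le_mul_of_nonneg_left h2 (by positivity : 0 ≤ γ * b)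
  have e3 := mul_le_mul_of_nonneg_left h3 (by linarith : 0 ≤ γ * (γ - 1) - b)
  have e4 := mul_le_mul_of_nonneg_left h4 (by positivity : 0 ≤ γ * (γ - 1))
  linarith

namespace IsBestSeq

variable {θ : Fin 3 → ℝ} {z : ℕ → Fin 4 → ℤ}

lemma tendsto_product (h : IsBestSeq θ z) {γ c : ℝ} (hγ : 1 < γ)
    (h1 : ∀ᶠ n in atTop, Real.log |form θ (toReal (z n))| ≤
      c - γ * Real.log (height (toReal (z (n + 1))))) :
    Tendsto (fun n => |form θ (toReal (z n))| * height (toReal (z (n + 1)))) atTop (nhds 0) := by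
  have hu : Tendsto (fun n => Real.log (height (toReal (z (n + 1))))) atTop atTop :=
    Real.tendsto_log_atTop.comp (h.tendsto_height.comp (tendsto_add_atTop_nat 1))
  have hlim : Tendsto (fun n => Real.exp (c - (γ - 1) * Real.log (height (toReal (z (n + 1))))))
      atTop (nhds 0) := by
    refine Real.tendsto_exp_atBot.comp ?_
    simp only [sub_eq_add_neg c]
    exact tendsto_atBot_add_const_left _ _
      (tendsto_neg_atTop_atBot.comp (hu.const_mul_atTop (by linarith)))
  refine squeeze_zero' (Eventually.of_forall fun n =>
    mul_nonneg (abs_nonneg _) (height_nonneg _)) ?_ hlim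
  filter_upwards [h1] with n hn
  have hX := h.height_pos (n + 1)
  rw [← Real.log_le_iff_le_exp (mul_pos (h.form_pos n) hX),
    Real.log_mul (h.form_pos n).ne' hX.ne']
  linarith

/-- The inequality between a uniform exponent `γ` and a bound `b` for the individual one. -/
lemma exponent_inequality (h : IsBestSeq θ z) {γ b c : ℝ} (hγ : 1 < γ) (hb : 0 < b)
    (h1 : ∀ᶠ n in atTop, Real.log |form θ (toReal (z n))| ≤
      c - γ * Real.log (height (toReal (z (n + 1)))))
    (h2 : ∀ᶠ n in atTop, -(b * Real.log (height (toReal (z n)))) ≤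
      Real.log |form θ (toReal (z n))|) :
    γ ^ 2 * (γ - 1) ≤ γ * b + b ^ 2 := by
  have h0 := h.tendsto_product hγ h1
  have hu : Tendsto (fun n => Real.log (height (toReal (z n)))) atTop atTop :=
    Real.tendsto_log_atTop.comp h.tendsto_height
  have hγ1 : 0 < γ - 1 := by linarith
  have hγ0 : 0 < γ := by linarith
  rcases le_total (γ * (γ - 1)) b with hbγ | hbγ
  · nlinarith
  by_contra! hcon
  obtain ⟨N₀, hN₀⟩ := eventually_atTop.1 (h1.and h2)
  by_cases hS : ∃ S : Submodule ℝ (Fin 4 → ℝ), S ≠ ⊤ ∧ ∃ N, ∀ n ≥ N, toReal (z n) ∈ S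
  · obtain ⟨S, hS, N, hN⟩ := hS
    obtain ⟨H, hH, hbound⟩ := h.triple_bound hS hN
    -- Equality would already give the desired inequality, contrary to `hcon`.
    have hlt : b < γ * (γ - 1) := by
      refine hbγ.lt_of_ne fun e => ?_
      nlinarith
    set K : ℝ := γ * c + γ * Real.log (24 * H) + c with hK
    obtain ⟨N₁, hN₁⟩ := eventually_atTop.1
      (hu.eventually_gt_atTop (K / (γ * (γ - 1) - b)))
    obtain ⟨i, hi, hip⟩ := h.exists_triple h0 (max N (max N₀ N₁))
    have hiN : N ≤ i := (le_max_left _ _).trans hi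
    have hiN₀ : N₀ ≤ i := (le_max_left _ _).trans ((le_max_right _ _).trans hi)
    have hiN₁ : N₁ ≤ i := (le_max_right _ _).trans ((le_max_right _ _).trans hi)
    have hb1 := hbound i hiN hip
    have hL := (h.form_pos i).ne'
    have hX1 := (h.height_pos (i + 1)).ne'
    have hX2 := (h.height_pos (i + 2)).ne'
    have hlog := Real.log_nonneg hb1
    have hexp : Real.log (24 * (|form θ (toReal (z i))| * height (toReal (z (i + 1))) *
        height (toReal (z (i + 2))) * H)) = Real.log (24 * H) +
        (Real.log |form θ (toReal (z i))| + Real.log (height (toReal (z (i + 1)))) +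
          Real.log (height (toReal (z (i + 2))))) := by
      rw [← Real.log_mul hL hX1, ← Real.log_mul (mul_ne_zero hL hX1) hX2,
        ← Real.log_mul (by positivity) (mul_ne_zero (mul_ne_zero hL hX1) hX2)]
      congr 1
      ring
    rw [hexp] at hlog
    have a1 := (hN₀ i hiN₀).1
    have a2 := (hN₀ (i + 1) (by omega)).1
    have a3 := (hN₀ (i + 1) (by omega)).2
    have a4 := hN₁ (i + 1) (by omega)
    rw [div_lt_iff₀ (by linarith)] at a4
    have a5 : 0 ≤ γ * (Real.log (24 * H) + (c - γ * Real.log (height (toReal (z (i + 1)))) +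
        Real.log (height (toReal (z (i + 1)))) + Real.log (height (toReal (z (i + 2)))))) :=
      mul_nonneg hγ0.le (by linarith)
    have a6 : γ * Real.log (height (toReal (z (i + 2)))) ≤
        c + b * Real.log (height (toReal (z (i + 1)))) := by linarith
    nlinarith
  · push Not at hS
    set C : ℝ := |c| + Real.log 24 with hC
    have hlog4 : Real.log 4 ≤ Real.log 24 := Real.log_le_log (by norm_num) (by norm_num)
    have hlog4' : 0 ≤ Real.log 4 := Real.log_nonneg (by norm_num)
    have hcC := le_abs_self c
    set F : ℝ := (γ - 1) * (γ ^ 2 * (γ - 1) - (γ * b + b ^ 2)) with hFdef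
    have hFpos : 0 < F := mul_pos hγ1 (by linarith)
    set K : ℝ := γ ^ 2 * (γ - 1) * C + γ * (γ - 1) * C + γ * b * C + (γ * (γ - 1) - b) * C
    obtain ⟨N₁, hN₁⟩ := eventually_atTop.1 (hu.eventually_gt_atTop (K / F))
    obtain ⟨i, hi, k, hik, hk, hk1, hli⟩ := h.exists_quadruple h0 hS (max N₀ N₁)
    have hiN₀ : N₀ ≤ i := (le_max_left _ _).trans hi
    have hiN₁ : N₁ ≤ i := (le_max_right _ _).trans hi
    have hlog := Real.log_nonneg (h.quadruple_bound hik hli)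
    have hX := fun n => (h.height_pos n).ne'
    have hL := fun n => (h.form_pos n).ne'
    rw [Real.log_mul (by norm_num) (by simp only [ne_eq, mul_eq_zero, hX, hL, or_self,
      not_false_eq_true]), Real.log_mul (mul_ne_zero (mul_ne_zero (hL _) (hX _)) (hX _)) (hX _),
      Real.log_mul (mul_ne_zero (hL _) (hX _)) (hX _), Real.log_mul (hL _) (hX _)] at hlog
    have hpl := Real.log_le_log (mul_pos (h.form_pos _) (h.height_pos _))
      (h.product_le_of_mem_plane hk hk1)
    rw [Real.log_mul (hL _) (hX _), Real.log_mul (by norm_num) (mul_ne_zero (hL _) (hX _)),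
      Real.log_mul (hL _) (hX _)] at hpl
    have a1 := (hN₀ i hiN₀).1
    have a2 := hN₀ (i + 1) (by omega)
    have a3 := hN₀ k (by omega)
    have a4 := hN₀ (k + 1) (by omega)
    have a5 := hN₁ (i + 1) (by omega)
    rw [div_lt_iff₀ hFpos] at a5
    -- The four inputs are the determinant bound, the product comparison between `i + 1` and `k`,
    -- and the two exponent bounds combined at `i + 1` and at `k + 1`.
    have := growth_bound (C := C) (u := Real.log (height (toReal (z (i + 1)))))
      (v := Real.log (height (toReal (z (i + 2)))))
      (w := Real.log (height (toReal (z (k + 1)))))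
      (w' := Real.log (height (toReal (z (k + 2))))) hγ hb hbγ
      (by linarith) (by linarith [a2.2, a3.1]) (by linarith [a2.1, a2.2])
      (by linarith [a4.1, a4.2])
    linarith

end IsBestSeq

/-! ### The function `psi` -/

lemma zeta_eq (Θ : Matrix (Fin 1) (Fin 3) ℝ) (x : Fin 3 → ℤ) :
    zeta Θ x = distInt (linForm Θ 0 x) := by
  simp [zeta]

lemma zeta_nonneg (Θ : Matrix (Fin 1) (Fin 3) ℝ) (x : Fin 3 → ℤ) : 0 ≤ zeta Θ x := by
  rw [zeta_eq]; exact abs_nonneg _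

lemma psi_nonneg (Θ : Matrix (Fin 1) (Fin 3) ℝ) (t : ℝ) : 0 ≤ psi Θ t := by
  refine Real.sInf_nonneg ?_
  rintro _ ⟨x, -, rfl⟩
  exact zeta_nonneg Θ x

lemma form_toReal_cons (Θ : Matrix (Fin 1) (Fin 3) ℝ) (y : ℤ) (x : Fin 3 → ℤ) :
    form (Θ 0) (toReal (Fin.cons y x)) = linForm Θ 0 x + y := by
  rw [form_apply, linForm, add_comm]
  simp [toReal]

lemma psi_le (Θ : Matrix (Fin 1) (Fin 3) ℝ) {z : Fin 4 → ℤ} {t : ℝ} (h0 : 0 < height (toReal z))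
    (ht : height (toReal z) ≤ t) : psi Θ t ≤ |form (Θ 0) (toReal z)| := by
  obtain ⟨y, x, rfl⟩ : ∃ y x, z = Fin.cons y x := ⟨z 0, Fin.tail z, (Fin.cons_self_tail z).symm⟩
  rw [height_toReal_cons] at h0 ht
  have hmem : zeta Θ x ∈ zeta Θ '' {x : Fin 3 → ℤ | 0 < ‖x‖ ∧ ‖x‖ ≤ t} := ⟨x, ⟨h0, ht⟩, rfl⟩
  refine (csInf_le ⟨0, ?_⟩ hmem).trans ?_
  · rintro _ ⟨x, -, rfl⟩
    exact zeta_nonneg Θ x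
  · rw [zeta_eq, form_toReal_cons, distInt]
    have := round_le (linForm Θ 0 x) (-y)
    simpa using this

lemma le_psi (Θ : Matrix (Fin 1) (Fin 3) ℝ) {K t : ℝ} (ht : 1 ≤ t)
    (h : ∀ z : Fin 4 → ℤ, 0 < height (toReal z) → height (toReal z) ≤ t →
      K ≤ |form (Θ 0) (toReal z)|) : K ≤ psi Θ t := by
  refine le_csInf ⟨_, (fun _ => 1), ⟨?_, ?_⟩, rfl⟩ ?_
  · rw [pi_norm_const]; simp
  · rw [pi_norm_const]; simpa using ht
  · rintro _ ⟨x, ⟨hx0, hx⟩, rfl⟩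
    have := h (Fin.cons (-round (linForm Θ 0 x)) x) (by rwa [height_toReal_cons])
      (by rwa [height_toReal_cons])
    rw [form_toReal_cons] at this
    rw [zeta_eq, distInt]
    simpa [sub_eq_add_neg] using this

/-- The exponent inequality in terms of `psi`. -/
lemma psi_exponent_inequality (Θ : Matrix (Fin 1) (Fin 3) ℝ)
    (hΘ : ∀ z : Fin 4 → ℤ, z ≠ 0 → form (Θ 0) (toReal z) ≠ 0) {γ b C : ℝ} (hγ : 1 < γ)
    (hb : 0 < b) (h1 : ∀ᶠ t in atTop, t ^ γ * psi Θ t ≤ C)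
    (h2 : ∀ᶠ t in atTop, 1 ≤ t ^ b * psi Θ t) :
    γ ^ 2 * (γ - 1) ≤ γ * b + b ^ 2 := by
  obtain ⟨z, hz⟩ := exists_isBestSeq (Θ 0) hΘ
  have hX := hz.tendsto_height
  have hX1 := hX.comp (tendsto_add_atTop_nat 1)
  refine hz.exponent_inequality (c := Real.log (max C 1) + γ * Real.log 2) hγ hb ?_ ?_
  · have hX2 : Tendsto (fun n => height (toReal (z (n + 1))) / 2) atTop atTop :=
      hX1.atTop_div_const two_pos
    filter_upwards [hX2.eventually h1, hX2.eventually_ge_atTop 1] with n hn hn1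
    have hXp := hz.height_pos (n + 1)
    have hLp := hz.form_pos n
    have hle : |form (Θ 0) (toReal (z n))| ≤ psi Θ (height (toReal (z (n + 1))) / 2) :=
      le_psi Θ hn1 fun w hw0 hw => hz.le_form n w (ne_zero_of_height_pos hw0) (by linarith)
    have hpow : 0 < (height (toReal (z (n + 1))) / 2) ^ γ := Real.rpow_pos_of_pos (by linarith) _
    have h3 := ((mul_le_mul_of_nonneg_left hle hpow.le).trans hn).trans (le_max_left C 1)
    have h4 := Real.log_le_log (mul_pos hpow hLp) h3
    rw [Real.log_mul hpow.ne' hLp.ne', Real.log_rpow (by linarith),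
      Real.log_div hXp.ne' two_ne_zero] at h4
    linarith
  · filter_upwards [hX.eventually h2] with n hn
    have hXp := hz.height_pos n
    have hLp := hz.form_pos n
    have hpow : 0 < height (toReal (z n)) ^ b := Real.rpow_pos_of_pos hXp _
    have h3 := hn.trans (mul_le_mul_of_nonneg_left (psi_le Θ hXp le_rfl) hpow.le)
    have h4 := Real.log_nonneg h3
    rw [Real.log_mul hpow.ne' hLp.ne', Real.log_rpow hXp] at h4
    linarith

/-! ### The exponents -/

lemma eventually_le_of_lt_uniformExponent (Θ : Matrix (Fin 1) (Fin 3) ℝ) {γ : ℝ}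
    (h : (γ : EReal) < uniformExponent Θ) : ∃ C : ℝ, ∀ᶠ t in atTop, t ^ γ * psi Θ t ≤ C := by
  obtain ⟨_, ⟨δ, -, rfl, hδ⟩, hlt⟩ := lt_sSup_iff.1 h
  obtain ⟨C, hC, -⟩ := EReal.lt_iff_exists_real_btwn.1 hδ
  refine ⟨C, ?_⟩
  filter_upwards [eventually_lt_of_limsup_lt hC, eventually_ge_atTop 1] with t ht ht1
  have h1 : t ^ δ * psi Θ t < C := by exact_mod_cast ht
  have h2 : t ^ γ ≤ t ^ δ := Real.rpow_le_rpow_of_exponent_le ht1 (by exact_mod_cast hlt.le)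
  exact (mul_le_mul_of_nonneg_right h2 (psi_nonneg Θ t)).trans h1.le

lemma eventually_le_of_individualExponent_lt (Θ : Matrix (Fin 1) (Fin 3) ℝ) {b : ℝ} (hb : 0 < b)
    (h : individualExponent Θ < b) : ∀ᶠ t in atTop, 1 ≤ t ^ b * psi Θ t := by
  have h1 : ¬ liminf (fun t : ℝ => ((t ^ b * psi Θ t : ℝ) : EReal)) atTop < ⊤ := fun h1 =>
    absurd h (not_lt.2 (le_sSup ⟨b, hb, rfl, h1⟩))
  have h2 : ((1 : ℝ) : EReal) < liminf (fun t : ℝ => ((t ^ b * psi Θ t : ℝ) : EReal)) atTop := by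
    rw [not_lt_top_iff.1 h1]; exact EReal.coe_lt_top 1
  filter_upwards [eventually_lt_of_lt_liminf h2] with t ht
  exact_mod_cast ht.le

lemma three_le_uniformExponent (Θ : Matrix (Fin 1) (Fin 3) ℝ) : 3 ≤ uniformExponent Θ := by
  refine le_sSup ⟨3, by norm_num, rfl, ?_⟩
  -- Here 8 = 2³, from t ≤ 2⌊t⌋.
  refine lt_of_le_of_lt (limsup_le_of_le (a := ((8 : ℝ) : EReal)) (h := ?_)) (EReal.coe_lt_top 8)
  filter_upwards [eventually_ge_atTop 1] with t ht
  have hN : 0 < ⌊t⌋₊ := Nat.floor_pos.2 ht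
  obtain ⟨z, h1, h2, h3⟩ := dirichlet (Θ 0) ⌊t⌋₊ hN
  have h4 := (psi_le Θ h1 (h2.trans (Nat.floor_le (by linarith)))).trans h3
  have hN1 : (1 : ℝ) ≤ ⌊t⌋₊ := by exact_mod_cast hN
  have h5 : t ≤ 2 * ⌊t⌋₊ := by linarith [Nat.lt_floor_add_one t]
  have h6 : t ^ 3 ≤ (2 * (⌊t⌋₊ : ℝ)) ^ 3 := pow_le_pow_left₀ (by linarith) h5 3
  have h7 : t ^ (3 : ℝ) * psi Θ t ≤ 8 := by
    rw [show (3 : ℝ) = ((3 : ℕ) : ℝ) by norm_num, Real.rpow_natCast]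
    calc t ^ 3 * psi Θ t ≤ (2 * (⌊t⌋₊ : ℝ)) ^ 3 * (1 / (⌊t⌋₊ : ℝ) ^ 3) :=
          mul_le_mul h6 h4 (psi_nonneg Θ t) (by positivity)
      _ = 8 := by field_simp; norm_num
  exact_mod_cast h7

/-! ### Estimates for `g2` and conclusion -/

/-- The hypothesis says (g + 1/2)² ≥ a - 3/4 for g = b / a, which already implies the weaker bound
expressed by `g2`. -/
lemma g2_bound {a b : ℝ} (ha : 3 ≤ a) (hb : 0 < b) (h : a ^ 2 * (a - 1) ≤ a * b + b ^ 2) :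
    a * g2 a ≤ b := by
  have ha0 : 0 < a := by linarith
  set g := b / a with hg
  have hbg : b = a * g := by rw [hg]; field_simp
  have hg0 : 0 < g := div_pos hb ha0
  have h1 : a - 1 ≤ g + g ^ 2 := by
    rw [hbg] at h
    have : a ^ 2 * (a - 1) ≤ a ^ 2 * (g + g ^ 2) := by linarith
    exact le_of_mul_le_mul_left this (by positivity)
  have hi : 1 / a ≤ 1 / 3 := one_div_le_one_div_of_le (by norm_num) ha
  have hi0 : 0 < 1 / a := by positivity
  have hia : 1 / a * a = 1 := by field_simp
  set i := 1 / a with hidef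
  have hsq : 1 / a ^ 2 = i ^ 2 := by rw [hidef, one_div_pow]
  rw [hbg]
  refine mul_le_mul_of_nonneg_left ?_ ha0.le
  rw [g2, hsq]
  have hs : Real.sqrt (a + i ^ 2 - 7 / 4) ≤ g + 1 / 2 - i := by
    refine Real.sqrt_le_iff.2 ⟨by linarith, ?_⟩
    -- After squaring, the claim is (g + 1/2)² - (2g + 1) / a ≥ a - 7/4. If 2g + 1 ≤ a, the
    -- subtracted term is at most 1. Otherwise the left side is at least a²/4 - 1, and (a - 1)(a -
    -- 3) ≥ 0 suffices.
    rcases le_total (2 * g + 1) a with hc | hc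
    · nlinarith
    · nlinarith
  linarith

lemma jarnik_lt_g2 {a : ℝ} (ha : 3 ≤ a) : a ^ (3 / 2 : ℝ) - 3 * a < a * g2 a := by
  have ha0 : 0 < a := by linarith
  have h1 : a ^ (3 / 2 : ℝ) = a * Real.sqrt a := by
    rw [Real.sqrt_eq_rpow, show (3 / 2 : ℝ) = 1 + 1 / 2 by norm_num, Real.rpow_add ha0,
      Real.rpow_one]
  have hs := Real.sq_sqrt ha0.le
  have hs0 := Real.sqrt_nonneg a
  -- The condition √a ≥ 8/5 is exactly (√a - 5/2)² ≤ a - 7/4.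
  have hs1 : 8 / 5 ≤ Real.sqrt a := Real.le_sqrt_of_sq_le (by norm_num; linarith)
  have hi : 0 < 1 / a := by positivity
  have hi2 : 0 < 1 / a ^ 2 := by positivity
  have h2 : Real.sqrt a - 5 / 2 ≤ Real.sqrt (a + 1 / a ^ 2 - 7 / 4) :=
    Real.le_sqrt_of_sq_le (by nlinarith)
  have h3 : Real.sqrt a - 3 < g2 a := by rw [g2]; linarith
  rw [h1]
  nlinarith

lemma form_ne_zero {θ₁ θ₂ θ₃ : ℝ} (h : LinearIndependent ℤ ![1, θ₁, θ₂, θ₃]) (z : Fin 4 → ℤ)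
    (hz : z ≠ 0) : form ((!![θ₁, θ₂, θ₃] : Matrix (Fin 1) (Fin 3) ℝ) 0) (toReal z) ≠ 0 := by
  intro h0
  refine hz (funext (Fintype.linearIndependent_iff.1 h z ?_))
  rw [form_apply] at h0
  rw [← h0]
  simp [Fin.sum_univ_succ, toReal, mul_comm]

end Diophantine

end

open Diophantine in
theorem theorem3 :
    (∀ θ₁ θ₂ θ₃ : ℝ, LinearIndependent ℤ ![1, θ₁, θ₂, θ₃] →
      (3 : EReal) ≤ Diophantine.uniformExponent !![θ₁, θ₂, θ₃] ∧
      (∀ a : ℝ, Diophantine.uniformExponent !![θ₁, θ₂, θ₃] = (a : EReal) →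
        ((a * Diophantine.g2 a : ℝ) : EReal) ≤ Diophantine.individualExponent !![θ₁, θ₂, θ₃]) ∧
      (Diophantine.uniformExponent !![θ₁, θ₂, θ₃] = ⊤ →
        Diophantine.individualExponent !![θ₁, θ₂, θ₃] = ⊤)) ∧
    (∀ a : ℝ, 3 ≤ a → a ^ (3 / 2 : ℝ) - 3 * a < a * Diophantine.g2 a) := by
  refine ⟨fun θ₁ θ₂ θ₃ hθ => ?_, fun a ha => jarnik_lt_g2 ha⟩
  have hform := form_ne_zero hθ
  generalize (!![θ₁, θ₂, θ₃] : Matrix (Fin 1) (Fin 3) ℝ) = Θ at hform ⊢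
  have hmain : ∀ γ b : ℝ, 1 < γ → 0 < b → (γ : EReal) < uniformExponent Θ →
      individualExponent Θ < b → γ ^ 2 * (γ - 1) ≤ γ * b + b ^ 2 := fun γ b hγ hb h1 h2 => by
    obtain ⟨C, hC⟩ := eventually_le_of_lt_uniformExponent Θ h1
    exact psi_exponent_inequality Θ hform hγ hb hC (eventually_le_of_individualExponent_lt Θ hb h2)
  have h3 := three_le_uniformExponent Θ
  refine ⟨h3, fun a ha => ?_, fun htop => ?_⟩
  · have ha3 : 3 ≤ a := by rw [ha] at h3; exact EReal.coe_le_coe_iff.1 h3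
    by_contra! hcon
    obtain ⟨b', hb'1, hb'2⟩ := EReal.lt_iff_exists_real_btwn.1 hcon
    have hpos : 0 < a * g2 a := by
      have h1 : 1 / 2 < Real.sqrt (a + 1 / a ^ 2 - 7 / 4) := by
        have : 0 < 1 / a ^ 2 := by positivity
        exact Real.lt_sqrt_of_sq_lt (by linarith)
      have h2 : 0 < 1 / a := by positivity
      exact mul_pos (by linarith) (by rw [g2]; linarith)
    have hb'3 : b' < a * g2 a := by exact_mod_cast hb'2
    obtain ⟨b, hb1, hb2⟩ := exists_between (max_lt hb'3 hpos)
    have hb0 : 0 < b := (le_max_right _ _).trans_lt hb1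
    have hib : individualExponent Θ < b :=
      hb'1.trans (by exact_mod_cast (le_max_left b' 0).trans_lt hb1)
    -- The exponent inequality is available only for γ strictly below the uniform exponent, so `a`
    -- is approached from the left.
    have hev : ∀ᶠ γ in nhdsWithin a (Set.Iio a), γ ^ 2 * (γ - 1) ≤ γ * b + b ^ 2 := by
      have hgt : ∀ᶠ γ in nhdsWithin a (Set.Iio a), 1 < γ :=
        nhdsWithin_le_nhds (lt_mem_nhds (by linarith))
      filter_upwards [hgt, self_mem_nhdsWithin] with γ hγ hγa
      exact hmain γ b hγ hb0 (by rw [ha]; exact_mod_cast hγa) hib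
    have hlim : a ^ 2 * (a - 1) ≤ a * b + b ^ 2 := by
      have c1 : Continuous fun γ : ℝ => γ ^ 2 * (γ - 1) := by fun_prop
      have c2 : Continuous fun γ : ℝ => γ * b + b ^ 2 := by fun_prop
      exact le_of_tendsto_of_tendsto (c1.continuousWithinAt (s := Set.Iio a))
        (c2.continuousWithinAt (s := Set.Iio a)) hev
    linarith [g2_bound ha3 hb0 hlim]
  · by_contra hne
    obtain ⟨b', hb', -⟩ := EReal.lt_iff_exists_real_btwn.1 (lt_top_iff_ne_top.2 hne)
    have hb : individualExponent Θ < ((|b'| + 1 : ℝ) : EReal) :=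
      hb'.trans (by exact_mod_cast (le_abs_self b').trans_lt (lt_add_one _))
    have hpos := abs_nonneg b'
    -- With γ = b + 3 the cubic side exceeds the quadratic one.
    have := hmain (|b'| + 4) (|b'| + 1) (by linarith) (by linarith)
      (by rw [htop]; exact EReal.coe_lt_top _) hb
    nlinarith
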